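/- Consider preemptive scheduling on a single machine. An instance consists of finitely many jobs $j$, each with a release date $r_j \ge 0$ and a processing time $p_j > 0$. A schedule is given by functions $y_j(t)$, the amount of processing that job $j$ has received until time $t$: each $y_j$ is nondecreasing, $y_j(t) = 0$ for $t \le r_j$, $y_j \le p_j$, and $\sum_j (y_j(t) - y_j(s)) \le t - s$ for all $s \le t$ (so the machine has unit speed and may share its processing power among jobs). The completion time $C_j$ is the earliest time $t$ with $y_j(t) = p_j$ ($C_j = \infty$ if there is none), the total flow time is $\sum_j (C_j - r_j)$, and $\mathrm{OPT}(I)$ is the minimum total flow time of a schedule for the instance $I$. For $\alpha \in [0,1)$, a deterministic $\alpha$-clairvoyant algorithm is an online algorithm which learns of the existence of a job $j$ only at time $r_j$, and learns $p_j$ only when the job emits its signal, that is, at the earliest time $t \ge r_j$ with $y_j(t) \ge \alpha p_j$; its schedule up to any time $T$ depends only on the information obtained before $T$. A randomized $\alpha$-clairvoyant algorithm is a random choice of a deterministic one (independent of the instance). Its competitive ratio is the smallest $\rho \in [0,\infty]$ such that on every instance $I$ its expected total flow time is at most $\rho \cdot \mathrm{OPT}(I)$. Theorem. There is an absolute constant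 $c > 0$ such that for every $\alpha \in [0,1)$, every randomized $\alpha$-clairvoyant algorithm for minimizing the total flow time on a single machine has competitive ratio at least $\frac{c}{1-\alpha}$. -/

import Mathlib

open MeasureTheory
open scoped ENNReal

namespace FlowTime

/-- An instance of single-machine scheduling with release dates: finitely many jobs, labelled by
natural numbers, each with a nonnegative release date and a positive processing time.
(The values of `release` and `proc` at labels outside `jobs` are irrelevant.) -/
structure Instance where
  jobs : Finset ℕ
  release : ℕ → ℝ
  proc : ℕ → ℝ
  release_nonneg : ∀ j ∈ jobs, 0 ≤ release j
  proc_pos : ∀ j ∈ jobs, 0 < proc j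

/-- `y j t` is the amount of processing that job `j` has received until time `t`. It is a feasible
preemptive schedule on one machine of unit speed (whose power may be shared among jobs). -/
structure IsSchedule (I : Instance) (y : ℕ → ℝ → ℝ) : Prop where
  mono : ∀ j, Monotone (y j)
  zero_of_notMem : ∀ j, j ∉ I.jobs → ∀ t, y j t = 0
  zero_of_le_release : ∀ j ∈ I.jobs, ∀ t, t ≤ I.release j → y j t = 0
  le_proc : ∀ j ∈ I.jobs, ∀ t, y j t ≤ I.proc j
  capacity : ∀ s t, s ≤ t → ∑ j ∈ I.jobs, (y j t - y j s) ≤ t - s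

/-- The completion time of job `j`: the earliest time at which it is fully processed
(`∞` if that never happens). -/
noncomputable def completionTime (I : Instance) (y : ℕ → ℝ → ℝ) (j : ℕ) : ℝ≥0∞ :=
  ⨅ (t : ℝ) (_ : y j t = I.proc j), ENNReal.ofReal t

/-- The sum over all jobs of completion time minus release date. -/
noncomputable def totalFlowTime (I : Instance) (y : ℕ → ℝ → ℝ) : ℝ≥0∞ :=
  ∑ j ∈ I.jobs, (completionTime I y j - ENNReal.ofReal (I.release j))

/-- The offline optimum. -/
noncomputable def opt (I : Instance) : ℝ≥0∞ :=
  ⨅ (y : ℕ → ℝ → ℝ) (_ : IsSchedule I y), totalFlowTime I y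

/-- Job `j` has been released by time `t`. -/
def Released (I : Instance) (j : ℕ) (t : ℝ) : Prop :=
  j ∈ I.jobs ∧ I.release j ≤ t

/-- Job `j` has emitted its signal by time `t`: it is released and an `α`-fraction of it has been
processed. -/
def Emitted (α : ℝ) (I : Instance) (y : ℕ → ℝ → ℝ) (j : ℕ) (t : ℝ) : Prop :=
  Released I j t ∧ α * I.proc j ≤ y j t

/-- What an `α`-clairvoyant scheduler knows at time `t` is the same in the run `y` on `I` and in the
run `y'` on `I'`: the same jobs are released, the same jobs have emitted, and the jobs that have
emitted have the same processing times. -/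
def SameInfo (α : ℝ) (I : Instance) (y : ℕ → ℝ → ℝ) (I' : Instance) (y' : ℕ → ℝ → ℝ)
    (t : ℝ) : Prop :=
  ∀ j, (Released I j t ↔ Released I' j t) ∧
    (Emitted α I y j t ↔ Emitted α I' y' j t) ∧
    (Emitted α I y j t → I.proc j = I'.proc j)

/-- A deterministic `α`-clairvoyant online algorithm: it produces a feasible schedule for every
instance, and its processing decisions up to time `T` depend only on what it has learned before
`T`. -/
structure Algorithm (α : ℝ) where
  schedule : Instance → ℕ → ℝ → ℝ
  feasible : ∀ I, IsSchedule I (schedule I)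
  online : ∀ (I I' : Instance) (T : ℝ),
    (∀ t < T, SameInfo α I (schedule I) I' (schedule I') t) →
      ∀ j, schedule I j T = schedule I' j T

/-- A randomized `α`-clairvoyant online algorithm: a random deterministic one, whose total flow time
on each fixed instance is a random variable. -/
structure RandomizedAlgorithm (α : ℝ) (Ω : Type*) [MeasurableSpace Ω] where
  law : Measure Ω
  isProbabilityMeasure : IsProbabilityMeasure law
  alg : Ω → Algorithm α
  measurable_flow : ∀ I, Measurable fun ω => totalFlowTime I ((alg ω).schedule I)



/-- The expected total flow time on a fixed instance. -/
noncomputable def RandomizedAlgorithm.expectedFlowTime {α : ℝ} {Ω : Type*}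
    [MeasurableSpace Ω] (A : RandomizedAlgorithm α Ω)
    (I : Instance) : ℝ≥0∞ :=
  ∫⁻ ω, totalFlowTime I ((A.alg ω).schedule I) ∂A.law

/-- The algorithm is `ρ`-competitive. -/
def RandomizedAlgorithm.IsCompetitive {α : ℝ} {Ω : Type*}
    [MeasurableSpace Ω] (A : RandomizedAlgorithm α Ω) (ρ : ℝ≥0∞) : Prop :=
  ∀ I, A.expectedFlowTime I ≤ ρ * opt I

/-- The smallest `ρ` such that the algorithm is `ρ`-competitive. -/
noncomputable def RandomizedAlgorithm.competitiveRatio {α : ℝ} {Ω : Type*}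
    [MeasurableSpace Ω] (A : RandomizedAlgorithm α Ω) : ℝ≥0∞ :=
  sInf {ρ | A.IsCompetitive ρ}

end FlowTime

/-!
Release `n` jobs at time `0` whose sizes are independent and geometric with parameter `1 / 2`,
truncated at about `1 / (1 - α)`, and from time `T` on release unit jobs at the speed of the
machine, for a very long time. Let `T` be the expected total size of the jobs that are not
truncated.

By memorylessness, a job that has not emitted its signal has expected remaining work `O(1)`, however
much it has been processed; a job that has emitted it has remaining work at most `1 - α` times its
size, which is again `O(1)`. So the online algorithm has, in expectation, a constant number of
unfinished jobs per unit of unfinished work. From time `T` on the unfinished work is on average at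
least `n 2 ^ (-m) (m + 1)`, the expected total size of the truncated jobs, where `m` is about
`1 / (1 - α)`. The offline optimum instead postpones the truncated jobs, about `n 2 ^ (-m)` many,
and `O(√n)` others that absorb the deviation of the total size from its mean, to the very end. For
`n = 4 ^ m` the ratio of the numbers of unfinished jobs is of order `m`.
-/

namespace FlowTime

open Filter Finset ProbabilityTheory Topology
open scoped NNReal

section Schedule

variable {I : Instance} {y : ℕ → ℝ → ℝ}

theorem IsSchedule.nonneg (h : IsSchedule I y) (j : ℕ) (t : ℝ) : 0 ≤ y j t := by
  by_cases hj : j ∈ I.jobs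
  · rw [← h.zero_of_le_release j hj (min t (I.release j)) (min_le_right _ _)]
    exact h.mono j (min_le_left _ _)
  · exact (h.zero_of_notMem j hj t).ge

theorem IsSchedule.eq_zero_of_nonpos (h : IsSchedule I y) (j : ℕ) {t : ℝ} (ht : t ≤ 0) :
    y j t = 0 := by
  by_cases hj : j ∈ I.jobs
  · exact h.zero_of_le_release j hj t (ht.trans (I.release_nonneg j hj))
  · exact h.zero_of_notMem j hj t

theorem IsSchedule.sub_le (h : IsSchedule I y) (j : ℕ) {s t : ℝ} (hst : s ≤ t) :
    y j t - y j s ≤ t - s := by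
  by_cases hj : j ∈ I.jobs
  · exact (single_le_sum (f := fun j => y j t - y j s)
      (fun i _ => sub_nonneg.2 (h.mono i hst)) hj).trans (h.capacity s t hst)
  · simp [h.zero_of_notMem j hj, hst]

theorem IsSchedule.continuous (h : IsSchedule I y) (j : ℕ) : Continuous (y j) := by
  refine (LipschitzWith.of_le_add fun s t => ?_).continuous
  rcases le_total s t with hst | hts
  · exact (h.mono j hst).trans (le_add_of_nonneg_right dist_nonneg)
  · rw [Real.dist_eq, abs_of_nonneg (sub_nonneg.2 hts)]
    linarith [h.sub_le j hts]

theorem IsSchedule.sum_le (h : IsSchedule I y) {t : ℝ} (ht : 0 ≤ t) :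
    ∑ j ∈ I.jobs, y j t ≤ t := by
  simpa [h.eq_zero_of_nonpos _ le_rfl] using h.capacity 0 t ht

theorem IsSchedule.ofReal_le_completionTime (h : IsSchedule I y) {j : ℕ} {t : ℝ}
    (ht : y j t < I.proc j) : ENNReal.ofReal t ≤ completionTime I y j := by
  refine le_iInf₂ fun u hu => ENNReal.ofReal_le_ofReal ?_
  by_contra! hut
  exact (h.mono j hut.le).not_gt (hu ▸ ht)

end Schedule

section Information

variable {α : ℝ} {I I' : Instance} {y y' : ℕ → ℝ → ℝ}

theorem eventually_nhdsGT_le_iff {g : ℝ → ℝ} (hmono : Monotone g) (hcont : Continuous g)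
    (c x : ℝ) : ∀ᶠ u in 𝓝[>] x, (c ≤ g u ↔ c ≤ g x) := by
  rcases le_or_gt c (g x) with hc | hc
  · filter_upwards [self_mem_nhdsWithin] with u hu
    exact iff_of_true (hc.trans (hmono (le_of_lt hu))) hc
  · filter_upwards [nhdsWithin_le_nhds (hcont.continuousAt.eventually_lt_const hc)] with u hu
    exact iff_of_false hu.not_ge hc.not_ge

theorem eventually_nhdsGT_released_iff (I : Instance) (x : ℝ) :
    ∀ᶠ u in 𝓝[>] x, ∀ j, Released I j u ↔ Released I j x := by
  have hjobs : ∀ᶠ u in 𝓝[>] x, ∀ j ∈ I.jobs, (I.release j ≤ u ↔ I.release j ≤ x) :=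
    (eventually_all_finset _).2 fun j _ => eventually_nhdsGT_le_iff monotone_id continuous_id _ x
  filter_upwards [hjobs] with u hu j
  exact and_congr_right (hu j)

theorem IsSchedule.eventually_nhdsGT_emitted_iff (h : IsSchedule I y) (α x : ℝ) :
    ∀ᶠ u in 𝓝[>] x, ∀ j, Emitted α I y j u ↔ Emitted α I y j x := by
  have hjobs : ∀ᶠ u in 𝓝[>] x, ∀ j ∈ I.jobs, (α * I.proc j ≤ y j u ↔ α * I.proc j ≤ y j x) :=
    (eventually_all_finset _).2 fun j _ => eventually_nhdsGT_le_iff (h.mono j) (h.continuous j) _ x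
  filter_upwards [eventually_nhdsGT_released_iff I x, hjobs] with u hrel hproc j
  rw [Emitted, Emitted, hrel j]
  exact and_congr_right fun hj => hproc j hj.1

theorem SameInfo.eventually_nhdsGT {x : ℝ} (hinfo : SameInfo α I y I' y' x)
    (h : IsSchedule I y) (h' : IsSchedule I' y') :
    ∀ᶠ u in 𝓝[>] x, SameInfo α I y I' y' u := by
  filter_upwards [eventually_nhdsGT_released_iff I x, eventually_nhdsGT_released_iff I' x,
    h.eventually_nhdsGT_emitted_iff α x, h'.eventually_nhdsGT_emitted_iff α x]
    with u hrel hrel' hemit hemit' j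
  rw [hrel j, hrel' j, hemit j, hemit' j]
  exact hinfo j

-- At the infimum of the times with different information the runs still agree, so by hypothesis
-- the information there is the same, and then it stays the same for a while.
theorem Algorithm.schedule_eq_of_sameInfo_of_eq (A : Algorithm α) {t : ℝ}
    (hinfo : ∀ x < t, (∀ i, A.schedule I i x = A.schedule I' i x) →
      SameInfo α I (A.schedule I) I' (A.schedule I') x) (i : ℕ) :
    A.schedule I i t = A.schedule I' i t := by
  refine A.online I I' t (fun x hxt => ?_) i
  by_contra hx
  set bad : Set ℝ := {x | x < t ∧ ¬ SameInfo α I (A.schedule I) I' (A.schedule I') x}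
  have hxbad : x ∈ bad := ⟨hxt, hx⟩
  have hbdd : BddBelow bad := ⟨0, fun u hu => not_lt.1 fun hu0 => hu.2 <| hinfo u hu.1 fun i => by
    rw [(A.feasible I).eq_zero_of_nonpos i hu0.le, (A.feasible I').eq_zero_of_nonpos i hu0.le]⟩
  have hinf : sInf bad < t := (csInf_le hbdd hxbad).trans_lt hxt
  have heq := A.online I I' (sInf bad) fun u hu => by
    by_contra hne
    exact notMem_of_lt_csInf hu hbdd ⟨hu.trans hinf, hne⟩
  have hsame := hinfo _ hinf heq
  obtain ⟨z, hz, hIoo⟩ := mem_nhdsGT_iff_exists_Ioo_subset.1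
    (hsame.eventually_nhdsGT (A.feasible I) (A.feasible I'))
  obtain ⟨u, hu, huz⟩ := exists_lt_of_csInf_lt ⟨x, hxbad⟩ hz
  rcases (csInf_le hbdd hu).eq_or_lt with hinfu | hinfu
  · exact hu.2 (hinfu ▸ hsame)
  · exact hu.2 (hIoo ⟨hinfu, huz⟩)

theorem Algorithm.schedule_eq_of_not_emitted (A : Algorithm α) {j : ℕ}
    (hjobs : I.jobs = I'.jobs) (hrelease : I.release = I'.release)
    (hproc : ∀ i ≠ j, I.proc i = I'.proc i) {t : ℝ} (hj : A.schedule I j t < α * I.proc j)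
    (hj' : A.schedule I j t < α * I'.proc j) (i : ℕ) :
    A.schedule I i t = A.schedule I' i t := by
  refine A.schedule_eq_of_sameInfo_of_eq (fun x hxt heq i => ?_) i
  have hreleased : Released I i x ↔ Released I' i x := by simp [Released, hjobs, hrelease]
  rcases eq_or_ne i j with rfl | hij
  · have hmono := (A.feasible I).mono i hxt.le
    have hne : ¬ Emitted α I (A.schedule I) i x := fun h => (hmono.trans_lt hj).not_ge h.2
    have hne' : ¬ Emitted α I' (A.schedule I') i x :=
      fun h => (hmono.trans_lt hj').not_ge (h.2.trans (heq i).ge)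
    exact ⟨hreleased, iff_of_false hne hne', fun h => absurd h hne⟩
  · refine ⟨hreleased, ?_, fun _ => hproc i hij⟩
    rw [Emitted, Emitted, hreleased, hproc i hij, heq i]

end Information

section Unfinished

variable {I : Instance} {y : ℕ → ℝ → ℝ}

/-- The number of jobs that are released but not yet completed at time `t`. Its integral over time
bounds the total flow time from below. -/
noncomputable def numUnfinished (I : Instance) (y : ℕ → ℝ → ℝ) (t : ℝ) : ℕ :=
  #{j ∈ I.jobs | I.release j ≤ t ∧ y j t < I.proc j}

theorem IsSchedule.measurableSet_unfinished (h : IsSchedule I y) (j : ℕ) :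
    MeasurableSet {t | I.release j ≤ t ∧ y j t < I.proc j} :=
  measurableSet_Ici.inter (measurableSet_lt (h.continuous j).measurable measurable_const)

theorem IsSchedule.measurable_numUnfinished (h : IsSchedule I y) :
    Measurable (numUnfinished I y) := by
  simp only [funext fun t => show numUnfinished I y t = _ from card_filter _ _]
  exact Finset.measurable_fun_sum _ fun j _ =>
    Measurable.ite (h.measurableSet_unfinished j) measurable_const measurable_const

theorem IsSchedule.volume_unfinished_le (h : IsSchedule I y) {j : ℕ} (hj : j ∈ I.jobs) :
    volume {t | I.release j ≤ t ∧ y j t < I.proc j} ≤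
      completionTime I y j - ENNReal.ofReal (I.release j) := by
  by_cases hC : completionTime I y j = ∞
  · simp [hC]
  · rw [← ENNReal.ofReal_toReal hC, ← ENNReal.ofReal_sub _ (I.release_nonneg j hj),
      ← Real.volume_Icc]
    exact measure_mono fun t ht =>
      ⟨ht.1, (ENNReal.ofReal_le_iff_le_toReal hC).1 (h.ofReal_le_completionTime ht.2)⟩

theorem IsSchedule.lintegral_numUnfinished_le (h : IsSchedule I y) :
    ∫⁻ t, numUnfinished I y t ≤ totalFlowTime I y := by
  have hcard (t : ℝ) : (numUnfinished I y t : ℝ≥0∞) =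
      ∑ j ∈ I.jobs, {t | I.release j ≤ t ∧ y j t < I.proc j}.indicator 1 t := by
    rw [numUnfinished, natCast_card_filter]
    simp only [Set.indicator_apply, Set.mem_ofPred_eq, Pi.one_apply]
  simp only [hcard]
  rw [lintegral_finsetSum _ fun j _ => measurable_one.indicator (h.measurableSet_unfinished j)]
  refine sum_le_sum fun j hj => ?_
  rw [lintegral_indicator_one (h.measurableSet_unfinished j)]
  exact h.volume_unfinished_le hj

end Unfinished

section Batches

variable {I : Instance} {batch : ℕ → ℕ} {τ : ℕ → ℝ}

/-- The jobs of `I` can be divided into batches that are processed one after another, the batch `k`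
of the jobs `j` with `batch j = k` during the interval `(τ k, τ (k + 1)]`. -/
structure IsBatching (I : Instance) (batch : ℕ → ℕ) (τ : ℕ → ℝ) : Prop where
  release_le : ∀ j ∈ I.jobs, I.release j ≤ τ (batch j)
  volume_le : ∀ k, ∑ j ∈ I.jobs with batch j = k, I.proc j ≤ τ (k + 1) - τ k

/-- The schedule that processes the jobs `j` with `batch j = k` simultaneously during the interval
`(τ k, τ (k + 1)]`, each at the constant speed that completes it at time `τ (k + 1)`. -/
noncomputable def batchSchedule (I : Instance) (batch : ℕ → ℕ) (τ : ℕ → ℝ) (j : ℕ) (t : ℝ) : ℝ :=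
  if j ∈ I.jobs then
    I.proc j / (τ (batch j + 1) - τ (batch j)) *
      volume.real (Set.Ioc (τ (batch j)) (τ (batch j + 1)) ∩ Set.Iic t)
  else 0

theorem measureReal_inter_Iic_sub {μ : Measure ℝ} {W : Set ℝ} (hW : μ W ≠ ∞) {s t : ℝ}
    (hst : s ≤ t) :
    μ.real (W ∩ Set.Iic t) - μ.real (W ∩ Set.Iic s) = μ.real (W ∩ Set.Ioc s t) := by
  have hdiff : (W ∩ Set.Iic t) \ Set.Iic s = W ∩ Set.Ioc s t := by
    rw [Set.inter_sdiff_assoc, Set.Iic_sdiff_Iic]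
  have hinter : W ∩ Set.Iic t ∩ Set.Iic s = W ∩ Set.Iic s := by
    rw [Set.inter_assoc, Set.Iic_inter_Iic, min_eq_right hst]
  rw [sub_eq_iff_eq_add', ← hinter, ← hdiff, measureReal_inter_add_sdiff measurableSet_Iic
    (measure_inter_ne_top_of_left_ne_top hW)]

theorem IsBatching.monotone (h : IsBatching I batch τ) : Monotone τ :=
  monotone_nat_of_le_succ fun k => sub_nonneg.1 <|
    (sum_nonneg fun j hj => (I.proc_pos j (filter_subset _ _ hj)).le).trans (h.volume_le k)

theorem IsBatching.length_pos (h : IsBatching I batch τ) {j : ℕ}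
    (hj : j ∈ I.jobs) : 0 < τ (batch j + 1) - τ (batch j) :=
  calc 0 < I.proc j := I.proc_pos j hj
    _ ≤ ∑ i ∈ I.jobs with batch i = batch j, I.proc i :=
        single_le_sum (fun i hi => (I.proc_pos i (filter_subset _ _ hi)).le)
          (mem_filter.2 ⟨hj, rfl⟩)
    _ ≤ τ (batch j + 1) - τ (batch j) := h.volume_le (batch j)

theorem IsBatching.batchSchedule_eq_proc (h : IsBatching I batch τ) {j : ℕ}
    (hj : j ∈ I.jobs) {t : ℝ} (ht : τ (batch j + 1) ≤ t) :
    batchSchedule I batch τ j t = I.proc j := by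
  have hlength := h.length_pos hj
  rw [batchSchedule, if_pos hj, Set.inter_eq_left.2 fun x hx => hx.2.trans ht,
    Real.volume_real_Ioc_of_le (sub_nonneg.1 hlength.le), div_mul_cancel₀ _ hlength.ne']

theorem IsBatching.monotone_batchSchedule (h : IsBatching I batch τ) (j : ℕ) :
    Monotone (batchSchedule I batch τ j) := by
  intro s t hst
  unfold batchSchedule
  split_ifs with hj
  · have := h.length_pos hj
    have := I.proc_pos j hj
    gcongr
    exact measure_inter_ne_top_of_left_ne_top measure_Ioc_lt_top.ne
  · rfl

theorem IsBatching.sum_batchSchedule_sub_le (h : IsBatching I batch τ) {s t : ℝ}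
    (hst : s ≤ t) :
    ∑ j ∈ I.jobs, (batchSchedule I batch τ j t - batchSchedule I batch τ j s) ≤ t - s := by
  set W : ℕ → Set ℝ := fun k => Set.Ioc (τ k) (τ (k + 1))
  calc ∑ j ∈ I.jobs, (batchSchedule I batch τ j t - batchSchedule I batch τ j s)
      = ∑ k ∈ I.jobs.image batch, ∑ j ∈ I.jobs with batch j = k,
          I.proc j / (τ (k + 1) - τ k) * volume.real (W k ∩ Set.Ioc s t) := by
        rw [← sum_fiberwise_of_maps_to fun j => mem_image_of_mem batch]
        refine sum_congr rfl fun k _ => sum_congr rfl fun j hj => ?_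
        obtain ⟨hjobs, rfl⟩ := mem_filter.1 hj
        rw [batchSchedule, batchSchedule, if_pos hjobs, if_pos hjobs, ← mul_sub,
          measureReal_inter_Iic_sub measure_Ioc_lt_top.ne hst]
    _ ≤ ∑ k ∈ I.jobs.image batch, volume.real (W k ∩ Set.Ioc s t) := by
        refine sum_le_sum fun k _ => ?_
        rw [← sum_mul, ← sum_div]
        exact mul_le_of_le_one_left measureReal_nonneg <|
          div_le_one_of_le₀ (h.volume_le k) (sub_nonneg.2 (h.monotone k.le_succ))
    _ = volume.real (⋃ k ∈ I.jobs.image batch, W k ∩ Set.Ioc s t) := by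
        refine (measureReal_biUnion_finset (fun k _ l _ hkl => ?_) (fun k _ => ?_)
          fun k _ => ?_).symm
        · exact (h.monotone.pairwise_disjoint_on_Ioc_succ hkl).mono Set.inter_subset_left
            Set.inter_subset_left
        · exact measurableSet_Ioc.inter measurableSet_Ioc
        · exact measure_inter_ne_top_of_left_ne_top measure_Ioc_lt_top.ne
    _ ≤ volume.real (Set.Ioc s t) :=
        measureReal_mono (Set.iUnion₂_subset fun _ _ => Set.inter_subset_right)
          measure_Ioc_lt_top.ne
    _ = t - s := Real.volume_real_Ioc_of_le hst

theorem IsBatching.isSchedule_batchSchedule (h : IsBatching I batch τ) :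
    IsSchedule I (batchSchedule I batch τ) where
  mono := h.monotone_batchSchedule
  zero_of_notMem j hj t := if_neg hj
  zero_of_le_release j hj t ht := by
    have hempty : Set.Ioc (τ (batch j)) (τ (batch j + 1)) ∩ Set.Iic t = ∅ :=
      Set.eq_empty_of_forall_notMem fun x hx => by
        linarith [hx.1.1, Set.mem_Iic.1 hx.2, h.release_le j hj]
    rw [batchSchedule, if_pos hj, hempty, measureReal_empty, mul_zero]
  le_proc j hj t := by
    rw [← h.batchSchedule_eq_proc hj (le_max_right t _)]
    exact h.monotone_batchSchedule j (le_max_left _ _)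
  capacity _ _ := h.sum_batchSchedule_sub_le

theorem IsBatching.opt_le (h : IsBatching I batch τ) :
    opt I ≤ ENNReal.ofReal (∑ j ∈ I.jobs, (τ (batch j + 1) - I.release j)) := by
  rw [ENNReal.ofReal_sum_of_nonneg fun j hj =>
    sub_nonneg.2 ((h.release_le j hj).trans (h.monotone (batch j).le_succ))]
  refine (iInf₂_le (batchSchedule I batch τ) h.isSchedule_batchSchedule).trans
    (sum_le_sum fun j hj => ?_)
  rw [ENNReal.ofReal_sub _ (I.release_nonneg j hj)]
  exact tsub_le_tsub_right (iInf₂_le (τ (batch j + 1)) (h.batchSchedule_eq_proc hj le_rfl)) _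

end Batches

section Resampling

variable {ι : Type*} [Fintype ι] [DecidableEq ι] {X : ι → Type*} [∀ i, MeasurableSpace (X i)]
  (μ : ∀ i, Measure (X i)) [∀ i, IsProbabilityMeasure (μ i)] (i : ι)

theorem measurePreserving_update :
    MeasurePreserving (fun p : (∀ j, X j) × X i => Function.update p.1 i p.2)
      ((Measure.pi μ).prod (μ i)) (Measure.pi μ) := by
  have hmeas : Measurable fun p : (∀ j, X j) × X i => Function.update p.1 i p.2 :=
    measurable_update'
  refine ⟨hmeas, (Measure.pi_eq fun s hs => ?_).symm⟩
  have hpre : (fun p : (∀ j, X j) × X i => Function.update p.1 i p.2) ⁻¹' Set.univ.pi s =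
      Set.univ.pi (Function.update s i Set.univ) ×ˢ s i := by
    ext p
    simp only [Set.mem_preimage, Set.mem_univ_pi, Set.mem_prod]
    rw [Function.forall_update_iff p.1 fun j x => x ∈ s j,
      Function.forall_update_iff s fun j u => p.1 j ∈ u]
    simp [and_comm]
  rw [Measure.map_apply hmeas (MeasurableSet.univ_pi hs), hpre, Measure.prod_prod, Measure.pi_pi,
    ← mul_prod_erase univ _ (mem_univ i), ← mul_prod_erase univ (fun j => μ j (s j)) (mem_univ i),
    Function.update_self, measure_univ, one_mul, mul_comm]
  congr 1
  exact prod_congr rfl fun j hj => by rw [Function.update_of_ne (ne_of_mem_erase hj)]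

theorem integral_pi_eq_integral_integral_update {F : (∀ j, X j) → ℝ}
    (hF : Integrable F (Measure.pi μ)) :
    ∫ f, F f ∂Measure.pi μ = ∫ f, ∫ x, F (Function.update f i x) ∂μ i ∂Measure.pi μ := by
  have hupdate := measurePreserving_update μ i
  calc ∫ f, F f ∂Measure.pi μ
      = ∫ p, F (Function.update p.1 i p.2) ∂(Measure.pi μ).prod (μ i) := by
        conv_lhs => rw [← hupdate.map_eq]
        refine integral_map hupdate.aemeasurable ?_
        rw [hupdate.map_eq]
        exact hF.aestronglyMeasurable
    _ = ∫ f, ∫ x, F (Function.update f i x) ∂μ i ∂Measure.pi μ :=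
        integral_prod _ (hupdate.integrable_comp_of_integrable hF)

end Resampling

section TruncatedGeometric

variable {m : ℕ}

theorem sum_range_inv_two_pow_succ_add (m : ℕ) :
    ∑ k ∈ range m, (2⁻¹ : ℝ≥0∞) ^ (k + 1) + 2⁻¹ ^ m = 1 := by
  induction m with
  | zero => simp
  | succ m ih =>
    rw [sum_range_succ, add_assoc, pow_succ, ← mul_add, ENNReal.inv_two_add_inv_two, mul_one, ih]

/-- The law of `min X m`, where `X` is the number of failures before the first success in
independent fair trials. -/
noncomputable def truncGeom (m : ℕ) : Measure (Fin (m + 1)) :=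
  (PMF.ofFintype (fun k : Fin (m + 1) => if (k : ℕ) < m then 2⁻¹ ^ ((k : ℕ) + 1) else 2⁻¹ ^ m) <| by
    simpa [Fin.sum_univ_castSucc, Fin.sum_univ_eq_sum_range fun k => (2⁻¹ : ℝ≥0∞) ^ (k + 1)]
      using sum_range_inv_two_pow_succ_add m).toMeasure

instance : IsProbabilityMeasure (truncGeom m) := PMF.toMeasure.isProbabilityMeasure _

theorem integral_truncGeom (m : ℕ) (g : ℕ → ℝ) :
    ∫ k, g k ∂truncGeom m = ∑ k ∈ range m, (1 / 2) ^ (k + 1) * g k + (1 / 2) ^ m * g m := by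
  simp [truncGeom, PMF.integral_eq_sum, Fin.sum_univ_castSucc,
    Fin.sum_univ_eq_sum_range fun k => ((2 : ℝ) ^ (k + 1))⁻¹ * g k]

theorem integral_truncGeom_succ (m : ℕ) (g : ℕ → ℝ) :
    ∫ k, g k ∂truncGeom (m + 1) =
      ∫ k, g k ∂truncGeom m + (1 / 2) ^ (m + 1) * (g (m + 1) - g m) := by
  rw [integral_truncGeom, integral_truncGeom, sum_range_succ]
  ring

-- Up to the truncation the law is memoryless: above any level the mean excess is `1`.
theorem integral_truncGeom_excess (m a : ℕ) :
    ∫ k, (if a ≤ (k : ℕ) then (k : ℝ) - a - 1 else 0) ∂truncGeom m =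
      (if a ≤ m then -(1 / 2) ^ m else 0 : ℝ) := by
  induction m with
  | zero =>
    rw [integral_truncGeom 0 fun k => if a ≤ k then (k : ℝ) - a - 1 else 0]
    rcases a.eq_zero_or_pos with rfl | ha
    · simp
    · simp [ha.ne']
  | succ m ih =>
    rw [integral_truncGeom_succ m fun k => if a ≤ k then (k : ℝ) - a - 1 else 0, ih]
    push_cast
    rcases lt_trichotomy a (m + 1) with ha | rfl | ha
    · rw [if_pos (Nat.lt_succ_iff.1 ha), if_pos ha.le, if_pos (Nat.lt_succ_iff.1 ha), if_pos ha.le]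
      ring
    · simp
    · simp [ha.not_ge, (m.lt_succ_self.trans ha).not_ge]

theorem integral_truncGeom_size_sq (m : ℕ) :
    ∫ k, ((k : ℝ) + 1) ^ 2 ∂truncGeom m = (6 - (2 * m + 5) * (1 / 2) ^ m : ℝ) := by
  induction m with
  | zero =>
    rw [integral_truncGeom 0 fun k => ((k : ℝ) + 1) ^ 2]
    norm_num
  | succ m ih =>
    rw [integral_truncGeom_succ m fun k => ((k : ℝ) + 1) ^ 2, ih]
    push_cast
    ring

/-- The size `k + 1` of a job, counted as `0` for the jobs of maximal size `m + 1`, which the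
offline schedule postpones. -/
noncomputable def smallSize (m k : ℕ) : ℝ := if k < m then k + 1 else 0

theorem smallSize_nonneg (m k : ℕ) : 0 ≤ smallSize m k := by
  unfold smallSize
  split_ifs <;> positivity

theorem integral_truncGeom_size (m : ℕ) :
    ∫ k, ((k : ℝ) + 1) ∂truncGeom m =
      ∫ k, smallSize m k ∂truncGeom m + (1 / 2) ^ m * ((m : ℝ) + 1) := by
  have hsum : ∑ k ∈ range m, (1 / 2 : ℝ) ^ (k + 1) * smallSize m k =
      ∑ k ∈ range m, (1 / 2) ^ (k + 1) * ((k : ℝ) + 1) :=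
    sum_congr rfl fun k hk => by rw [smallSize, if_pos (mem_range.1 hk)]
  rw [integral_truncGeom m fun k => (k : ℝ) + 1, integral_truncGeom m (smallSize m), hsum]
  simp [smallSize]

theorem integral_truncGeom_smallSize_sq_le (m : ℕ) :
    ∫ k, smallSize m k ^ 2 ∂truncGeom m ≤ 6 :=
  calc ∫ k, smallSize m k ^ 2 ∂truncGeom m ≤ ∫ k, ((k : ℝ) + 1) ^ 2 ∂truncGeom m :=
        integral_mono .of_finite .of_finite fun k => by
          unfold smallSize
          split_ifs
          · rfl
          · rw [zero_pow two_ne_zero]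
            positivity
    _ = 6 - (2 * m + 5) * (1 / 2) ^ m := integral_truncGeom_size_sq m
    _ ≤ 6 := sub_le_self _ (by positivity)

theorem integral_truncGeom_maximal (m : ℕ) :
    ∫ k, (if (k : ℕ) < m then 0 else 1) ∂truncGeom m = (1 / 2 : ℝ) ^ m := by
  rw [integral_truncGeom m fun k => if k < m then 0 else 1,
    sum_eq_zero fun k hk => by rw [if_pos (mem_range.1 hk), mul_zero]]
  simp

end TruncatedGeometric

section RemainingWork

variable {α : ℝ} {m : ℕ} {Y : Fin (m + 1) → ℝ}

theorem exists_signal_threshold (hα0 : 0 ≤ α) (hα1 : α ≤ 1) (hY : ∀ k, 0 ≤ Y k)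
    (hsame : ∀ k l : Fin (m + 1), Y k < α * (k + 1) → Y k < α * (l + 1) → Y k = Y l) :
    ∃ a : ℕ, ∀ k : Fin (m + 1),
      (k < a → α * (k + 1) ≤ Y k) ∧ (a ≤ k → α * a ≤ Y k ∧ Y k < k + 1) := by
  have hex : ∃ a : ℕ, ∀ k : Fin (m + 1), k = a → Y k < α * (k + 1) :=
    ⟨m + 1, fun k hk => absurd k.2 (by omega)⟩
  classical
  obtain ⟨a, ha, hmin⟩ : ∃ a : ℕ, (∀ k : Fin (m + 1), k = a → Y k < α * (k + 1)) ∧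
      ∀ k : Fin (m + 1), k < a → α * (k + 1) ≤ Y k :=
    ⟨Nat.find hex, Nat.find_spec hex, fun k hk => by
      obtain ⟨l, hl, hle⟩ : ∃ l : Fin (m + 1), (l : ℕ) = k ∧ α * (l + 1) ≤ Y l := by
        simpa using Nat.find_min hex hk
      rwa [← Fin.ext hl]⟩
  refine ⟨a, fun k => ⟨hmin k, fun hak => ?_⟩⟩
  have hlt : Y ⟨a, hak.trans_lt k.2⟩ < α * (a + 1) := ha _ rfl
  have hak' : (a : ℝ) ≤ k := Nat.cast_le.2 hak
  rw [← hsame _ k hlt (hlt.trans_le (by gcongr))]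
  refine ⟨?_, hlt.trans_le ?_⟩
  · rcases a with - | b
    · simpa using hY _
    · by_contra! hb
      have hb' := hmin ⟨b, by omega⟩ b.lt_succ_self
      rw [← hsame _ _ hlt (by exact_mod_cast hb)] at hb'
      exact hb'.not_gt (by exact_mod_cast hb)
  · calc α * (a + 1) ≤ 1 * (k + 1) := by gcongr
      _ = k + 1 := one_mul _

theorem remaining_le_of_signal_threshold (hα0 : 0 ≤ α) (hα1 : α ≤ 1) (hm : (1 - α) * m ≤ 1)
    {a : ℕ} {k : Fin (m + 1)} (hlt : k < a → α * (k + 1) ≤ Y k)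
    (hge : a ≤ k → α * a ≤ Y k ∧ Y k < k + 1) :
    k + 1 - Y k - (if Y k < k + 1 then 3 else 0) ≤ if a ≤ (k : ℕ) then (k : ℝ) - a - 1 else 0 := by
  have hscale {x : ℝ} (hx : x ≤ m) : (1 - α) * x ≤ 1 :=
    (mul_le_mul_of_nonneg_left hx (sub_nonneg.2 hα1)).trans hm
  have hkm : (k : ℝ) ≤ m := Nat.cast_le.2 k.is_le
  rcases lt_or_ge (k : ℕ) a with hka | hak
  · rw [if_neg hka.not_ge]
    split_ifs with hY
    · linarith [hlt hka, hscale hkm]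
    · linarith
  · obtain ⟨hαa, hYk⟩ := hge hak
    rw [if_pos hYk, if_pos hak]
    linarith [hscale ((Nat.cast_le.2 hak).trans hkm)]

theorem integral_truncGeom_remaining_nonpos (hα0 : 0 ≤ α) (hα1 : α ≤ 1) (hm : (1 - α) * m ≤ 1)
    (hY : ∀ k, 0 ≤ Y k)
    (hsame : ∀ k l : Fin (m + 1), Y k < α * (k + 1) → Y k < α * (l + 1) → Y k = Y l) :
    ∫ k, (k + 1 - Y k - if Y k < k + 1 then 3 else 0) ∂truncGeom m ≤ 0 := by
  obtain ⟨a, ha⟩ := exists_signal_threshold hα0 hα1 hY hsame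
  calc ∫ k, (k + 1 - Y k - if Y k < k + 1 then 3 else 0) ∂truncGeom m
      ≤ ∫ k, (if a ≤ (k : ℕ) then (k : ℝ) - a - 1 else 0) ∂truncGeom m :=
        integral_mono .of_finite .of_finite fun k =>
          remaining_le_of_signal_threshold hα0 hα1 hm (ha k).1 (ha k).2
    _ ≤ 0 := by
        rw [integral_truncGeom_excess]
        split_ifs
        · exact neg_nonpos.2 (by positivity)
        · rfl

end RemainingWork

section SizeLaw

/-- The joint law of the sizes of `n` independent jobs with truncated geometric sizes; a job of
size `k + 1` is encoded by `k`. -/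
noncomputable abbrev sizeLaw (n m : ℕ) : Measure (Fin n → Fin (m + 1)) :=
  Measure.pi fun _ => truncGeom m

theorem integral_sizeLaw_sum {n m : ℕ} (g : Fin (m + 1) → ℝ) :
    ∫ f, ∑ i, g (f i) ∂sizeLaw n m = n * ∫ k, g k ∂truncGeom m := by
  have hcoord (i : Fin n) : ∫ f, g (f i) ∂sizeLaw n m = ∫ k, g k ∂truncGeom m :=
    integral_comp_eval (μ := fun _ : Fin n => truncGeom m) .of_discrete
  rw [integral_finsetSum _ fun i _ => .of_finite, sum_congr rfl fun i _ => hcoord i]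
  simp

theorem integral_sizeLaw_sum_sub_sq_le {n m : ℕ} (g : Fin (m + 1) → ℝ) :
    ∫ f, (∑ i, g (f i) - n * ∫ k, g k ∂truncGeom m) ^ 2 ∂sizeLaw n m ≤
      n * ∫ k, g k ^ 2 ∂truncGeom m :=
  calc ∫ f, (∑ i, g (f i) - n * ∫ k, g k ∂truncGeom m) ^ 2 ∂sizeLaw n m
      = Var[fun f => ∑ i, g (f i); sizeLaw n m] := by
        rw [variance_eq_integral .of_discrete, integral_sizeLaw_sum]
    _ = ∑ _i : Fin n, Var[g; truncGeom m] := by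
        simpa only [sum_fn] using
          variance_sum_pi (μ := fun _ : Fin n => truncGeom m) (X := fun _ => g)
            fun _ => .of_discrete
    _ = n * Var[g; truncGeom m] := by simp
    _ ≤ n * ∫ k, g k ^ 2 ∂truncGeom m := by
        gcongr
        exact variance_le_expectation_sq .of_discrete

end SizeLaw

section HardInstance

/-- Jobs `i < n` of size `f i + 1` are released at time `0`, followed by `M` jobs `n + l` of unit
size, released one by one at the times `T + l`. -/
noncomputable def hardInstance {n m : ℕ} (M : ℕ) (T : ℝ≥0) (f : Fin n → Fin (m + 1)) :
    Instance where
  jobs := range (n + M)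
  release j := if j < n then 0 else T + (j - n : ℕ)
  proc j := if h : j < n then (f ⟨j, h⟩ : ℝ) + 1 else 1
  release_nonneg j _ := by split_ifs <;> positivity
  proc_pos j _ := by split_ifs <;> positivity

variable {n m M : ℕ} {T : ℝ≥0} {f : Fin n → Fin (m + 1)}

theorem hardInstance_release_coe (i : Fin n) : (hardInstance M T f).release i = 0 := by
  simp [hardInstance]

theorem hardInstance_proc_coe (i : Fin n) : (hardInstance M T f).proc i = f i + 1 := by
  simp [hardInstance]

theorem hardInstance_release_add (l : ℕ) : (hardInstance M T f).release (n + l) = T + l := by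
  simp [hardInstance]

theorem hardInstance_proc_add (l : ℕ) : (hardInstance M T f).proc (n + l) = 1 := by
  simp [hardInstance]

theorem sum_hardInstance_jobs {β : Type*} [AddCommMonoid β] (g : ℕ → β) :
    ∑ j ∈ (hardInstance M T f).jobs, g j = ∑ i : Fin n, g i + ∑ l ∈ range M, g (n + l) := by
  rw [Fin.sum_univ_eq_sum_range]
  exact sum_range_add _ _ _

theorem hardInstance_update_proc_of_ne {i : Fin n} {j : ℕ} (hj : j ≠ i) (k : Fin (m + 1)) :
    (hardInstance M T (Function.update f i k)).proc j = (hardInstance M T f).proc j := by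
  simp only [hardInstance]
  split_ifs with hjn
  · rw [Function.update_of_ne fun h => hj (congrArg Fin.val h)]
  · rfl

end HardInstance

section LowerBound

variable {n m M : ℕ} {T : ℝ≥0} {f : Fin n → Fin (m + 1)} {y : ℕ → ℝ → ℝ} {t : ℝ}

theorem numUnfinished_hardInstance (ht : 0 ≤ t) :
    (numUnfinished (hardInstance M T f) y t : ℝ) =
      ∑ i : Fin n, (if y i t < f i + 1 then 1 else 0) +
        ∑ l ∈ range M, if T + l ≤ t ∧ y (n + l) t < 1 then 1 else 0 := by
  rw [numUnfinished, natCast_card_filter, sum_hardInstance_jobs]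
  simp only [hardInstance_release_coe, hardInstance_proc_coe, hardInstance_release_add,
    hardInstance_proc_add, ht, true_and]

theorem le_card_range_filter_cast_le {x : ℝ} (hx : x < M) :
    x ≤ #{l ∈ range M | ((l : ℕ) : ℝ) ≤ x} := by
  rcases lt_or_ge x 0 with hx0 | hx0
  · exact hx0.le.trans (Nat.cast_nonneg _)
  have hsub : range (⌊x⌋₊ + 1) ⊆ {l ∈ range M | ((l : ℕ) : ℝ) ≤ x} := fun l hl => by
    have hlx : (l : ℝ) ≤ x := (Nat.le_floor_iff hx0).1 (mem_range_succ_iff.1 hl)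
    exact mem_filter.2 ⟨mem_range.2 (by exact_mod_cast hlx.trans_lt hx), hlx⟩
  calc x ≤ (⌊x⌋₊ + 1 : ℕ) := by exact_mod_cast (Nat.lt_floor_add_one x).le
    _ ≤ #{l ∈ range M | ((l : ℕ) : ℝ) ≤ x} := by
        exact_mod_cast (card_range _).ge.trans (card_le_card hsub)

-- The unit jobs arrive at the speed of the machine, so the volume of the unfinished work does not
-- drop below its value at time `T` before time `T + M`.
theorem IsSchedule.sum_size_sub_le_remaining (h : IsSchedule (hardInstance M T f) y) (hTt : T ≤ t)
    (htM : t < T + M) :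
    ∑ i, ((f i : ℝ) + 1) - T ≤ ∑ i : Fin n, (f i + 1 - y i t) +
      ∑ l ∈ range M, if T + l ≤ t ∧ y (n + l) t < 1 then 1 else 0 := by
  have harrived : t - T ≤ ∑ l ∈ range M, if T + l ≤ t then (1 : ℝ) else 0 := by
    simpa only [le_sub_iff_add_le', sum_boole] using
      le_card_range_filter_cast_le (sub_lt_iff_lt_add'.2 htM)
  have hprocessed : ∑ i : Fin n, y i t + ∑ l ∈ range M, y (n + l) t ≤ t :=
    (sum_hardInstance_jobs _).ge.trans (h.sum_le (T.2.trans hTt))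
  have hunit : ∑ l ∈ range M, ((if T + l ≤ t then (1 : ℝ) else 0) - y (n + l) t) ≤
      ∑ l ∈ range M, if T + l ≤ t ∧ y (n + l) t < 1 then 1 else 0 := by
    refine sum_le_sum fun l _ => ?_
    have := h.nonneg (n + l) t
    split_ifs <;> first | linarith | grind
  rw [sum_sub_distrib] at hunit ⊢
  linarith

theorem IsSchedule.sum_size_sub_le_three_mul_numUnfinished
    (h : IsSchedule (hardInstance M T f) y) (hTt : T ≤ t) (htM : t < T + M) :
    ∑ i, ((f i : ℝ) + 1) - T ≤
      ∑ i : Fin n, (f i + 1 - y i t - if y i t < f i + 1 then 3 else 0) +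
        3 * numUnfinished (hardInstance M T f) y t := by
  have hunit : 0 ≤ ∑ l ∈ range M, if T + l ≤ t ∧ y (n + l) t < 1 then (1 : ℝ) else 0 :=
    sum_nonneg fun l _ => by split_ifs <;> norm_num
  have hthree : ∑ i : Fin n, (if y i t < f i + 1 then (3 : ℝ) else 0) =
      3 * ∑ i : Fin n, if y i t < f i + 1 then (1 : ℝ) else 0 := by
    simp only [mul_sum, mul_ite, mul_one, mul_zero]
  rw [numUnfinished_hardInstance (T.2.trans hTt), sum_sub_distrib, hthree]
  linarith [h.sum_size_sub_le_remaining hTt htM]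

variable {α : ℝ} (A : Algorithm α)

theorem Algorithm.integral_remaining_nonpos (hα0 : 0 ≤ α) (hα1 : α ≤ 1)
    (hm : (1 - α) * m ≤ 1) (t : ℝ) (i : Fin n) :
    ∫ f, (f i + 1 - A.schedule (hardInstance M T f) i t -
      if A.schedule (hardInstance M T f) i t < f i + 1 then 3 else 0) ∂sizeLaw n m ≤ 0 := by
  rw [integral_pi_eq_integral_integral_update _ i .of_finite]
  refine integral_nonpos fun f => ?_
  simp only [Function.update_self]
  refine integral_truncGeom_remaining_nonpos hα0 hα1 hm
    (fun k => (A.feasible _).nonneg i t) fun k l hk hl => ?_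
  refine A.schedule_eq_of_not_emitted (I := hardInstance M T (Function.update f i k))
    (I' := hardInstance M T (Function.update f i l)) (j := i) rfl rfl (fun j hj => ?_) ?_ ?_ i
  · rw [hardInstance_update_proc_of_ne hj, hardInstance_update_proc_of_ne hj]
  · rwa [hardInstance_proc_coe, Function.update_self]
  · rwa [hardInstance_proc_coe, Function.update_self]

theorem Algorithm.le_integral_numUnfinished (hα0 : 0 ≤ α) (hα1 : α ≤ 1)
    (hm : (1 - α) * m ≤ 1) (hTt : T ≤ t) (htM : t < T + M) :
    (n * ∫ k, ((k : ℝ) + 1) ∂truncGeom m - T) / 3 ≤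
      ∫ f, (numUnfinished (hardInstance M T f) (A.schedule (hardInstance M T f)) t : ℝ)
        ∂sizeLaw n m := by
  have hmono := integral_mono (μ := sizeLaw n m) .of_finite .of_finite fun f =>
    (A.feasible (hardInstance M T f)).sum_size_sub_le_three_mul_numUnfinished hTt htM
  rw [integral_sub .of_finite .of_finite, integral_add .of_finite .of_finite,
    integral_sizeLaw_sum fun k => (k : ℝ) + 1, integral_finsetSum _ fun i _ => .of_finite,
    integral_const_mul, integral_const, probReal_univ, one_smul] at hmono
  have hremaining := sum_nonpos fun (i : Fin n) (_ : i ∈ univ) =>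
    A.integral_remaining_nonpos (M := M) (T := T) hα0 hα1 hm t i
  linarith

theorem Algorithm.le_lintegral_totalFlowTime (hα0 : 0 ≤ α) (hα1 : α ≤ 1)
    (hm : (1 - α) * m ≤ 1) :
    ENNReal.ofReal ((n * ∫ k, ((k : ℝ) + 1) ∂truncGeom m - T) / 3) * M ≤
      ∫⁻ f, totalFlowTime (hardInstance M T f) (A.schedule (hardInstance M T f)) ∂sizeLaw n m := by
  set N : (Fin n → Fin (m + 1)) → ℝ → ℕ := fun f =>
    numUnfinished (hardInstance M T f) (A.schedule (hardInstance M T f))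
  have hN : Measurable (Function.uncurry N) :=
    measurable_from_prod_countable_right fun f =>
      (A.feasible (hardInstance M T f)).measurable_numUnfinished
  calc ENNReal.ofReal ((n * ∫ k, ((k : ℝ) + 1) ∂truncGeom m - T) / 3) * M
      = ∫⁻ t in Set.Ico (T : ℝ) (T + M),
          ENNReal.ofReal ((n * ∫ k, ((k : ℝ) + 1) ∂truncGeom m - T) / 3) := by
        simp
    _ ≤ ∫⁻ t in Set.Ico (T : ℝ) (T + M), ∫⁻ f, N f t ∂sizeLaw n m := by
        refine setLIntegral_mono' measurableSet_Ico fun t ht => ?_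
        refine (ENNReal.ofReal_le_ofReal <|
          A.le_integral_numUnfinished hα0 hα1 hm ht.1 ht.2).trans_eq ?_
        rw [ofReal_integral_eq_lintegral_ofReal .of_finite (.of_forall fun f => Nat.cast_nonneg _)]
        simp only [ENNReal.ofReal_natCast, N]
    _ ≤ ∫⁻ t, ∫⁻ f, N f t ∂sizeLaw n m := setLIntegral_le_lintegral _ _
    _ = ∫⁻ f, (∫⁻ t, N f t) ∂sizeLaw n m :=
        lintegral_lintegral_swap (measurable_from_top.comp (hN.comp measurable_swap)).aemeasurable
    _ ≤ ∫⁻ f, totalFlowTime (hardInstance M T f) (A.schedule (hardInstance M T f)) ∂sizeLaw n m :=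
        lintegral_mono fun f => (A.feasible _).lintegral_numUnfinished_le

end LowerBound

section UpperBound

variable {n m M : ℕ} {T V : ℝ≥0} {f : Fin n → Fin (m + 1)} {D : Finset (Fin n)}

/-- The batches of an offline schedule for `hardInstance`: first the jobs of `D`, then the unit jobs
one by one, and finally the remaining jobs `i < n`. -/
def hardBatch (M : ℕ) (D : Finset (Fin n)) (j : ℕ) : ℕ :=
  if h : j < n then if ⟨j, h⟩ ∈ D then 0 else M + 1 else j - n + 1

/-- The times at which the batches of `hardBatch` start. The interval for the jobs outside `D`, of
total size at most `V`, has length `V + 1`. -/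
noncomputable def hardBreakpoint (M : ℕ) (T V : ℝ≥0) : ℕ → ℝ
  | 0 => 0
  | k + 1 => T + k + if k ≤ M then (0 : ℝ) else V

theorem hardBatch_coe (i : Fin n) : hardBatch M D i = if i ∈ D then 0 else M + 1 := by
  simp [hardBatch]

theorem hardBatch_add (l : ℕ) : hardBatch M D (n + l) = l + 1 := by
  simp [hardBatch]

theorem hardBreakpoint_sub (k : ℕ) :
    hardBreakpoint M T V (k + 2) - hardBreakpoint M T V (k + 1) =
      1 + if M = k then (V : ℝ) else 0 := by
  simp only [hardBreakpoint]
  split_ifs <;> first | omega | (push_cast; ring)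

theorem hardBatch_volume_le (hD : ∑ i ∈ D, ((f i : ℝ) + 1) ≤ T)
    (hV : ∑ i ∈ Dᶜ, ((f i : ℝ) + 1) ≤ V) (k : ℕ) :
    ∑ j ∈ (hardInstance M T f).jobs with hardBatch M D j = k, (hardInstance M T f).proc j ≤
      hardBreakpoint M T V (k + 1) - hardBreakpoint M T V k := by
  rw [sum_filter, sum_hardInstance_jobs]
  simp only [hardInstance_proc_coe, hardInstance_proc_add, hardBatch_coe, hardBatch_add]
  rcases k with - | k
  · simpa [hardBreakpoint] using hD
  have hremaining : ∑ i, (if (if i ∈ D then 0 else M + 1) = k + 1 then (f i : ℝ) + 1 else 0) =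
      if M = k then ∑ i ∈ Dᶜ, ((f i : ℝ) + 1) else 0 := by
    have hD0 : ∀ i ∈ D, (if (if i ∈ D then 0 else M + 1) = k + 1 then (f i : ℝ) + 1 else 0) = 0 :=
      fun i hi => by simp [hi]
    rw [← sum_compl_add_sum D, sum_eq_zero hD0, add_zero]
    split_ifs with hk
    · exact sum_congr rfl fun i hi => by simp [hk, mem_compl.1 hi]
    · exact sum_eq_zero fun i hi => by simp [hk, mem_compl.1 hi]
  have hunit : ∑ l ∈ range M, (if l + 1 = k + 1 then (1 : ℝ) else 0) ≤ 1 := by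
    simp only [add_left_inj, sum_ite_eq']
    split_ifs <;> norm_num
  rw [hardBreakpoint_sub, hremaining, add_comm]
  gcongr
  split_ifs <;> trivial

theorem isBatching_hardInstance (hD : ∑ i ∈ D, ((f i : ℝ) + 1) ≤ T)
    (hV : ∑ i ∈ Dᶜ, ((f i : ℝ) + 1) ≤ V) :
    IsBatching (hardInstance M T f) (hardBatch M D) (hardBreakpoint M T V) where
  release_le j hj := by
    rcases lt_or_ge j n with hjn | hjn
    · lift j to Fin n using hjn
      rw [hardInstance_release_coe, hardBatch_coe]
      split_ifs <;> simp only [hardBreakpoint] <;> positivity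
    · obtain ⟨l, rfl⟩ := Nat.exists_eq_add_of_le hjn
      rw [hardInstance_release_add, hardBatch_add, hardBreakpoint]
      exact le_add_of_nonneg_right (by split_ifs <;> positivity)
  volume_le := hardBatch_volume_le hD hV

theorem opt_hardInstance_le_of_subset (hD : ∑ i ∈ D, ((f i : ℝ) + 1) ≤ T)
    (hV : ∑ i ∈ Dᶜ, ((f i : ℝ) + 1) ≤ V) :
    opt (hardInstance M T f) ≤ ENNReal.ofReal (n * (T + V + 1) + M * (#Dᶜ + 1)) := by
  refine (isBatching_hardInstance hD hV).opt_le.trans (ENNReal.ofReal_le_ofReal ?_)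
  rw [sum_hardInstance_jobs]
  simp only [hardInstance_release_coe, hardInstance_release_add, hardBatch_coe, hardBatch_add]
  have hcoe (i : Fin n) : hardBreakpoint M T V ((if i ∈ D then 0 else M + 1) + 1) - 0 ≤
      T + V + 1 + if i ∈ D then 0 else (M : ℝ) := by
    have := V.2
    split_ifs <;> simp only [hardBreakpoint] <;> split_ifs <;> first | omega | (push_cast; linarith)
  have hunit : ∀ l ∈ range M, hardBreakpoint M T V (l + 1 + 1) - (T + l) = 1 := fun l hl => by
    simp [hardBreakpoint, mem_range.1 hl]
  have hremaining : ∑ i : Fin n, (if i ∈ D then 0 else (M : ℝ)) = #Dᶜ * M := by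
    rw [← sum_compl_add_sum D, sum_eq_zero fun i hi => if_pos hi, add_zero,
      sum_congr rfl fun i hi => if_neg (mem_compl.1 hi), sum_const, nsmul_eq_mul]
  calc _ ≤ ∑ i : Fin n, (T + V + 1 + if i ∈ D then 0 else (M : ℝ)) + ∑ _l ∈ range M, (1 : ℝ) :=
        add_le_add (sum_le_sum fun i _ => hcoe i) (sum_congr rfl hunit).le
    _ = n * (T + V + 1) + M * (#Dᶜ + 1) := by
        rw [sum_add_distrib, hremaining, sum_const, sum_const, card_univ, Fintype.card_fin,
          card_range, nsmul_eq_mul, nsmul_eq_mul]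
        ring

theorem exists_subset_sum_le {ι : Type*} (S : Finset ι) {p : ι → ℝ} (hp : ∀ i ∈ S, 1 ≤ p i)
    {T : ℝ} (hT : 0 ≤ T) :
    ∃ D ⊆ S, ∑ i ∈ D, p i ≤ T ∧ (#S : ℝ) ≤ #D + (max (∑ i ∈ S, p i - T) 0 + 1) := by
  classical
  induction S using Finset.induction_on with
  | empty => exact ⟨∅, Subset.rfl, by simpa using hT, by simpa using by positivity⟩
  | insert a S ha ih =>
    obtain ⟨hpa, hpS⟩ := forall_mem_insert _ _ _ |>.1 hp
    rcases le_or_gt (∑ i ∈ insert a S, p i) T with hfit | hexceed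
    · exact ⟨insert a S, Subset.rfl, hfit, by simp [max_eq_right (sub_nonpos.2 hfit)]⟩
    rw [max_eq_left (sub_pos.2 hexceed).le]
    rw [sum_insert ha] at hexceed ⊢
    rcases le_or_gt (∑ i ∈ S, p i) T with hfitS | hexceedS
    · refine ⟨S, subset_insert a S, hfitS, ?_⟩
      rw [card_insert_of_notMem ha]
      push_cast
      linarith
    · obtain ⟨D, hDS, hDT, hcard⟩ := ih hpS
      refine ⟨D, hDS.trans (subset_insert a S), hDT, ?_⟩
      rw [max_eq_left (sub_pos.2 hexceedS).le] at hcard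
      rw [card_insert_of_notMem ha]
      push_cast
      linarith

theorem exists_subset_size_le (T : ℝ≥0) (f : Fin n → Fin (m + 1)) :
    ∃ D : Finset (Fin n), ∑ i ∈ D, ((f i : ℝ) + 1) ≤ T ∧
      (#Dᶜ : ℝ) ≤
        ∑ i, (if (f i : ℕ) < m then 0 else 1) + (max (∑ i, smallSize m (f i) - T) 0 + 1) := by
  obtain ⟨D, -, hDT, hcard⟩ := exists_subset_sum_le {i | (f i : ℕ) < m}
    (p := fun i => (f i : ℝ) + 1) (fun i _ => by simp) T.coe_nonneg
  have hcompl : (#Dᶜ : ℝ) + #D = #{i | (f i : ℕ) < m} + #{i | ¬ (f i : ℕ) < m} := by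
    rw [← Nat.cast_add, ← Nat.cast_add, card_compl_add_card, card_filter_add_card_filter_not,
      card_univ]
  have hmaximal : (#{i | ¬ (f i : ℕ) < m} : ℝ) = ∑ i, if (f i : ℕ) < m then (0 : ℝ) else 1 := by
    rw [natCast_card_filter]
    simp only [ite_not]
  have hsmall : ∑ i with (f i : ℕ) < m, ((f i : ℝ) + 1) = ∑ i, smallSize m (f i) := by
    rw [sum_filter]
    rfl
  refine ⟨D, hDT, ?_⟩
  rw [hsmall] at hcard
  rw [← hmaximal]
  linarith

theorem max_zero_le_add_sq_div (x : ℝ) {σ : ℝ} (hσ : 0 < σ) :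
    max x 0 ≤ σ + (4 * σ)⁻¹ * x ^ 2 := by
  refine max_le ?_ (by positivity)
  rw [← sub_nonneg]
  calc 0 ≤ (4 * σ)⁻¹ * (x - 2 * σ) ^ 2 := by positivity
    _ = σ + (4 * σ)⁻¹ * x ^ 2 - x := by field_simp; ring

theorem opt_hardInstance_le (hM : n * (T + n * (m + 1) + 1) ≤ (M : ℝ)) (f : Fin n → Fin (m + 1)) :
    opt (hardInstance M T f) ≤ ENNReal.ofReal (M *
      (∑ i, (if (f i : ℕ) < m then 0 else 1) + max (∑ i, smallSize m (f i) - T) 0 + 3)) := by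
  obtain ⟨D, hDT, hcard⟩ := exists_subset_size_le T f
  have hvolume : ∑ i ∈ Dᶜ, ((f i : ℝ) + 1) ≤ (n * (m + 1) : ℝ≥0) :=
    calc ∑ i ∈ Dᶜ, ((f i : ℝ) + 1) ≤ ∑ i, ((f i : ℝ) + 1) :=
          sum_le_univ_sum_of_nonneg fun i => by positivity
      _ ≤ ∑ _i : Fin n, ((m : ℝ) + 1) := by
          gcongr with i
          exact (f i).is_le
      _ = (n * (m + 1) : ℝ≥0) := by simp [mul_add]
  refine (opt_hardInstance_le_of_subset hDT hvolume).trans (ENNReal.ofReal_le_ofReal ?_)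
  calc n * (T + (n * (m + 1) : ℝ≥0) + 1) + M * (#Dᶜ + 1)
      ≤ M + M * (∑ i, (if (f i : ℕ) < m then 0 else 1) +
          (max (∑ i, smallSize m (f i) - T) 0 + 1) + 1) := by
        gcongr
        exact_mod_cast hM
    _ = M * (∑ i, (if (f i : ℕ) < m then 0 else 1) +
          max (∑ i, smallSize m (f i) - T) 0 + 3) := by ring

theorem lintegral_opt_hardInstance_le (hT : T = n * ∫ k, smallSize m k ∂truncGeom m)
    (hM : n * (T + n * (m + 1) + 1) ≤ (M : ℝ)) {σ : ℝ} (hσ : 0 < σ) :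
    ∫⁻ f, opt (hardInstance M T f) ∂sizeLaw n m ≤
      ENNReal.ofReal (M * (n * (1 / 2) ^ m + (σ + (4 * σ)⁻¹ * (n * 6)) + 3)) := by
  set maximal : (Fin n → Fin (m + 1)) → ℝ := fun f => ∑ i, if (f i : ℕ) < m then 0 else 1
  set excess : (Fin n → Fin (m + 1)) → ℝ := fun f => ∑ i, smallSize m (f i) - T
  have hmaximal : ∫ f, maximal f ∂sizeLaw n m = n * (1 / 2) ^ m := by
    rw [← integral_truncGeom_maximal]
    exact integral_sizeLaw_sum fun k => if (k : ℕ) < m then 0 else 1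
  have hexcess : ∫ f, excess f ^ 2 ∂sizeLaw n m ≤ n * 6 := by
    simp only [excess, hT]
    refine (integral_sizeLaw_sum_sub_sq_le fun k => smallSize m k).trans ?_
    gcongr
    exact integral_truncGeom_smallSize_sq_le m
  calc ∫⁻ f, opt (hardInstance M T f) ∂sizeLaw n m
      ≤ ∫⁻ f, ENNReal.ofReal (M * (maximal f + (σ + (4 * σ)⁻¹ * excess f ^ 2) + 3))
          ∂sizeLaw n m := by
        refine lintegral_mono fun f => (opt_hardInstance_le hM f).trans ?_
        gcongr
        exact max_zero_le_add_sq_div _ hσ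
    _ = ENNReal.ofReal (∫ f, M * (maximal f + (σ + (4 * σ)⁻¹ * excess f ^ 2) + 3)
          ∂sizeLaw n m) := by
        refine (ofReal_integral_eq_lintegral_ofReal .of_finite (.of_forall fun f => ?_)).symm
        have : 0 ≤ maximal f := sum_nonneg fun i _ => by split_ifs <;> norm_num
        positivity
    _ = ENNReal.ofReal (M * (n * (1 / 2) ^ m +
          (σ + (4 * σ)⁻¹ * ∫ f, excess f ^ 2 ∂sizeLaw n m) + 3)) := by
        rw [integral_const_mul, integral_add .of_finite .of_finite,
          integral_add .of_finite .of_finite, integral_add .of_finite .of_finite,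
          integral_const_mul, hmaximal]
        simp
    _ ≤ ENNReal.ofReal (M * (n * (1 / 2) ^ m + (σ + (4 * σ)⁻¹ * (n * 6)) + 3)) := by
        gcongr

end UpperBound

section CompetitiveRatio

variable {α : ℝ} {Ω : Type*} [MeasurableSpace Ω] {A : RandomizedAlgorithm α Ω} {ρ : ℝ≥0∞}

-- Yao's principle.
theorem RandomizedAlgorithm.IsCompetitive.le_mul_lintegral_opt (hρ : A.IsCompetitive ρ)
    {β : Type*} [MeasurableSpace β] [Countable β] [MeasurableSingletonClass β] {μ : Measure β}
    [SFinite μ] (I : β → Instance) {a : ℝ≥0∞}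
    (ha : ∀ B : Algorithm α, a ≤ ∫⁻ b, totalFlowTime (I b) (B.schedule (I b)) ∂μ) :
    a ≤ ρ * ∫⁻ b, opt (I b) ∂μ := by
  have := A.isProbabilityMeasure
  calc a = ∫⁻ _ω, a ∂A.law := by simp
    _ ≤ ∫⁻ ω, ∫⁻ b, totalFlowTime (I b) ((A.alg ω).schedule (I b)) ∂μ ∂A.law :=
        lintegral_mono fun ω => ha (A.alg ω)
    _ = ∫⁻ b, A.expectedFlowTime (I b) ∂μ :=
        lintegral_lintegral_swap
          (measurable_from_prod_countable_left fun b => A.measurable_flow (I b)).aemeasurable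
    _ ≤ ∫⁻ b, ρ * opt (I b) ∂μ := lintegral_mono fun b => hρ (I b)
    _ = ρ * ∫⁻ b, opt (I b) ∂μ := lintegral_const_mul _ .of_discrete

theorem RandomizedAlgorithm.IsCompetitive.le_mul_of_sizeLaw (hρ : A.IsCompetitive ρ)
    (hα0 : 0 ≤ α) (hα1 : α ≤ 1) {m : ℕ} (hm : (1 - α) * m ≤ 1) (n : ℕ) {σ : ℝ} (hσ : 0 < σ) :
    ENNReal.ofReal (n * ((1 / 2) ^ m * (m + 1)) / 3) ≤
      ρ * ENNReal.ofReal (n * (1 / 2) ^ m + (σ + (4 * σ)⁻¹ * (n * 6)) + 3) := by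
  obtain ⟨T, hT⟩ : ∃ T : ℝ≥0, T = n * ∫ k, smallSize m k ∂truncGeom m :=
    ⟨⟨_, mul_nonneg n.cast_nonneg (integral_nonneg fun k : Fin (m + 1) => smallSize_nonneg m k)⟩,
      rfl⟩
  obtain ⟨M, hM⟩ := exists_nat_ge (n * (T + n * (m + 1) + 1) + 1 : ℝ)
  have hM0 : (0 : ℝ) < M := lt_of_lt_of_le (by positivity) hM
  have hlower (B : Algorithm α) : ENNReal.ofReal (n * ((1 / 2) ^ m * (m + 1)) / 3) * M ≤
      ∫⁻ f, totalFlowTime (hardInstance M T f) (B.schedule (hardInstance M T f))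
        ∂sizeLaw n m := by
    simpa only [integral_truncGeom_size, hT, mul_add (n : ℝ), add_sub_cancel_left] using
      B.le_lintegral_totalFlowTime (n := n) (M := M) (T := T) hα0 hα1 hm
  have hupper := lintegral_opt_hardInstance_le hT (by linarith) hσ
  rw [mul_comm (M : ℝ), ENNReal.ofReal_mul' hM0.le, ENNReal.ofReal_natCast] at hupper
  have hM0' : (M : ℝ≥0∞) ≠ 0 := by exact_mod_cast hM0.ne'
  refine (ENNReal.mul_le_mul_iff_left hM0' (ENNReal.natCast_ne_top M)).1 ?_
  rw [mul_assoc]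
  exact (hρ.le_mul_lintegral_opt (hardInstance M T) hlower).trans (mul_le_mul_right hupper ρ)

-- The choice `n = 4 ^ m` balances the expected number `n / 2 ^ m` of jobs of maximal size with the
-- standard deviation, of order `√n`, of the total size of the other jobs.
theorem RandomizedAlgorithm.IsCompetitive.add_one_div_le (hρ : A.IsCompetitive ρ) (hα0 : 0 ≤ α)
    (hα1 : α ≤ 1) {m : ℕ} (hm : (1 - α) * m ≤ 1) : ENNReal.ofReal ((m + 1) / 24) ≤ ρ := by
  have hpow : (0 : ℝ) < 2 ^ m := by positivity
  have hfour : ((4 ^ m : ℕ) : ℝ) = 2 ^ m * 2 ^ m := by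
    rw [← mul_pow]
    norm_num
  have hlower : ((4 ^ m : ℕ) : ℝ) * ((1 / 2) ^ m * (m + 1)) / 3 = (m + 1) / 24 * (8 * 2 ^ m) := by
    rw [hfour, one_div_pow]
    field_simp
    norm_num
  have hupper : ((4 ^ m : ℕ) : ℝ) * (1 / 2) ^ m + (2 ^ m + (4 * 2 ^ m)⁻¹ * ((4 ^ m : ℕ) * 6)) + 3 ≤
      8 * 2 ^ m := by
    have hone : (1 : ℝ) ≤ 2 ^ m := one_le_pow₀ one_le_two
    calc ((4 ^ m : ℕ) : ℝ) * (1 / 2) ^ m + (2 ^ m + (4 * 2 ^ m)⁻¹ * ((4 ^ m : ℕ) * 6)) + 3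
        = 7 / 2 * 2 ^ m + 3 := by
          rw [hfour, one_div_pow]
          field_simp
          ring
      _ ≤ 8 * 2 ^ m := by linarith
  have hcompare := (hρ.le_mul_of_sizeLaw hα0 hα1 hm (4 ^ m) hpow).trans
    (mul_le_mul_right (ENNReal.ofReal_le_ofReal hupper) ρ)
  rw [hlower, ENNReal.ofReal_mul (by positivity)] at hcompare
  refine (ENNReal.mul_le_mul_iff_left ?_ ENNReal.ofReal_ne_top).1 hcompare
  exact (ENNReal.ofReal_pos.2 (by positivity)).ne'

end CompetitiveRatio

end FlowTime

theorem theorem2 :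
    ∃ c : ℝ, 0 < c ∧
      ∀ α : ℝ, 0 ≤ α → α < 1 →
        ∀ (Ω : Type*) [MeasurableSpace Ω] (A : FlowTime.RandomizedAlgorithm α Ω),
          ENNReal.ofReal (c / (1 - α)) ≤ A.competitiveRatio := by
  refine ⟨1 / 24, by norm_num, fun α hα0 hα1 Ω _ A => le_sInf fun ρ hρ => ?_⟩
  have hα : 0 < 1 - α := sub_pos.2 hα1
  have hfloor : (1 - α) * ⌊1 / (1 - α)⌋₊ ≤ 1 := by
    rw [← le_div_iff₀' hα]
    exact Nat.floor_le (by positivity)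
  refine le_trans (ENNReal.ofReal_le_ofReal ?_) (hρ.add_one_div_le hα0 hα1.le hfloor)
  rw [div_right_comm]
  gcongr
  exact (Nat.lt_floor_add_one _).le
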